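/- Let $n,k\ge 1$ and $q,s\ge 0$ be integers, let $\sigma\ge 0$ and $\tau>0$. An image is a vector $x=(x_1,\dots,x_n)$ of pixels $x_i\in\mathbb R^q$, where $q$ is the number of channels; $\|\cdot\|_\infty$ denotes the maximum norm over all pixels and channels. The randomized discretization (RandDisc) of $x$ with hyperparameters $(s,k,\sigma,\tau)$ is the random image $\tilde x$ generated as follows. (1) Draw indices $i_1,\dots,i_s$ independently and uniformly from $\{1,\dots,n\}$, and, independently of them, independent noise vectors $\varepsilon_1,\dots,\varepsilon_s\sim\mathcal N(0,\tau^2 I_q)$; set $b_j=x_{i_j}+\varepsilon_j$ and $\mathbf b=(b_1,\dots,b_s)$. (2) Apply to $\mathbf b$ an arbitrary fixed, possibly randomized, selection algorithm (a Markov kernel from $(\mathbb R^q)^s$ to $(\mathbb R^q)^k$, the same for all images) to obtain cluster centers $\mathbf c=(c_1,\dots,c_k)$, with distribution $P_{\mathbf c}$. (3) For $v\in\mathbb R^q$ and $u=(u_1,\dots,u_k)\in(\mathbb R^q)^k$ let $$r(v|u)=\operatorname*{argmin}_{c\in\{u_1,\dots,u_k\}}\|v+w-c\|_2,\qquad w\sim\mathcal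 N(0,\sigma^2 I_q),$$ where ties are broken in favor of the smallest index. Set $\tilde x_i=r(x_i|\mathbf c)$ for $i=1,\dots,n$, with the noise vectors $w_1,\dots,w_n\sim\mathcal N(0,\sigma^2I_q)$ of the pixels independent of each other and of $\mathbf c$. Let $x,x'$ be two images with $\|x-x'\|_\infty\le\epsilon$, and let $\tilde x,\tilde x'$ be their RandDisc transformations (with the same hyperparameters and selection algorithm). Let $P_Z$ denote the distribution of a random variable $Z$, let $\mathrm{KL}(\cdot\|\cdot)\in[0,\infty]$ denote the Kullback–Leibler divergence, and let $P_{\mathbf c}$ be the distribution of the centers selected for $x$. Then, as an inequality in $[0,\infty]$, $$\mathrm{KL}(P_{\tilde x}\|P_{\tilde x'})\le\frac{s\,q\,\epsilon^2}{2\tau^2}+\sum_{i=1}^n\ \sup_{\Delta\in[-\epsilon,\epsilon]^q}\ \mathbb E_{u\sim P_{\mathbf c}}\Big[\mathrm{KL}\big(P_{r(x_i|u)}\,\big\|\,P_{r(x_i+\Delta|u)}\big)\Big].$$ -/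

import Mathlib

open MeasureTheory ProbabilityTheory InformationTheory
open scoped NNReal ENNReal

namespace RandDisc

/-- A pixel with `q` channels. The norm of this type is the sup norm; Euclidean distances are
always taken explicitly, through `WithLp.toLp 2`. -/
abbrev Pixel (q : ℕ) : Type := Fin q → ℝ

/-- An image with `n` pixels and `q` channels. The norm of this type is the sup norm over all
pixels and all channels. -/
abbrev Image (n q : ℕ) : Type := Fin n → Pixel q

/-- The Gaussian distribution `N(0, ρ² I)` on `ℝ^q`: independent `N(0, ρ²)` coordinates. -/
noncomputable def noise (q : ℕ) (ρ : ℝ≥0) : Measure (Pixel q) :=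
  Measure.pi fun _ => gaussianReal 0 (ρ ^ 2)

/-- The distribution of `b = (b_1, …, b_s)`, where `b_j = x_{i_j} + ε_j`, the indices
`i_1, …, i_s` are independent and uniform on the pixels (sampling with replacement), and
`ε_1, …, ε_s` are independent `N(0, τ² I)` vectors, independent of the indices. -/
noncomputable def sampleLaw {n q : ℕ} (s : ℕ) (τ : ℝ≥0) (x : Image n q) :
    Measure (Fin s → Pixel q) :=
  ((Measure.pi fun _ : Fin s => uniformOn (Set.univ : Set (Fin n))).prod
    (Measure.pi fun _ : Fin s => noise q τ)).map fun p j => x (p.1 j) + p.2 j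

/-- The distribution of the cluster centers `c = (c_1, …, c_k)`: the (possibly randomized)
selection algorithm `sel` is applied to `b`. -/
noncomputable def centerLaw {n q s k : ℕ} (τ : ℝ≥0)
    (sel : Kernel (Fin s → Pixel q) (Fin k → Pixel q)) (x : Image n q) :
    Measure (Fin k → Pixel q) :=
  (sampleLaw s τ x).bind sel

/-- The center `c_j` is at minimal Euclidean distance from `y` among all centers. -/
def IsNearest {q k : ℕ} (c : Fin k → Pixel q) (y : Pixel q) (j : Fin k) : Prop :=
  ∀ l, ‖WithLp.toLp 2 (y - c j)‖ ≤ ‖WithLp.toLp 2 (y - c l)‖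

theorem exists_isNearest {q k : ℕ} [NeZero k] (c : Fin k → Pixel q) (y : Pixel q) :
    ∃ j, IsNearest c y j := by
  obtain ⟨j, hj⟩ := Finite.exists_min fun l => ‖WithLp.toLp 2 (y - c l)‖
  exact ⟨j, hj⟩

open Classical in
/-- The smallest index of a center nearest to `y`. -/
noncomputable def nearestIndex {q k : ℕ} [NeZero k] (c : Fin k → Pixel q) (y : Pixel q) : Fin k :=
  (Finset.univ.filter (IsNearest c y)).min' <| by
    obtain ⟨j, hj⟩ := exists_isNearest c y
    exact ⟨j, by simpa using hj⟩

/-- `argmin_{c ∈ {c_1, …, c_k}} ‖y - c‖₂`, ties being broken in favour of the smallest index. -/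
noncomputable def nearest {q k : ℕ} [NeZero k] (c : Fin k → Pixel q) (y : Pixel q) : Pixel q :=
  c (nearestIndex c y)

theorem nearestIndex_eq_iff {q k : ℕ} [NeZero k] (c : Fin k → Pixel q) (y : Pixel q)
    (j : Fin k) :
    nearestIndex c y = j ↔ IsNearest c y j ∧ ∀ l, IsNearest c y l → j ≤ l := by
  classical
  rw [nearestIndex, Finset.min'_eq_iff]
  simp

/-- `nearest` is jointly measurable, so that the push-forwards below are genuine distributions. -/
theorem measurable_nearest {q k : ℕ} [NeZero k] :
    Measurable fun p : (Fin k → Pixel q) × Pixel q => nearest p.1 p.2 := by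
  have hN : ∀ j : Fin k,
      MeasurableSet {p : (Fin k → Pixel q) × Pixel q | IsNearest p.1 p.2 j} := by
    intro j
    have h : ∀ l : Fin k, Continuous fun p : (Fin k → Pixel q) × Pixel q =>
        ‖WithLp.toLp 2 (p.2 - p.1 l)‖ := by
      intro l
      exact ((PiLp.continuous_toLp 2 _).comp (by fun_prop)).norm
    simp only [IsNearest, Set.ofPred_forall]
    exact MeasurableSet.iInter fun l => measurableSet_le (h j).measurable (h l).measurable
  have hidx : Measurable fun p : (Fin k → Pixel q) × Pixel q => nearestIndex p.1 p.2 := by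
    refine measurable_to_countable' fun j => ?_
    have : (fun p : (Fin k → Pixel q) × Pixel q => nearestIndex p.1 p.2) ⁻¹' {j} =
        {p | IsNearest p.1 p.2 j} ∩ ⋂ l, {p | IsNearest p.1 p.2 l → j ≤ l} := by
      ext p
      simp [nearestIndex_eq_iff]
    rw [this]
    refine (hN j).inter (MeasurableSet.iInter fun l => ?_)
    exact (hN l).imp (MeasurableSet.const _)
  have hev : Measurable fun p : Fin k × (Fin k → Pixel q) => p.2 p.1 :=
    measurable_from_prod_countable_right fun j => measurable_pi_apply j
  exact hev.comp (hidx.prodMk measurable_fst)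

/-- The distribution of `r(v | c) = argmin_{c' ∈ {c_1, …, c_k}} ‖v + w - c'‖₂`, where
`w ∼ N(0, σ² I)`, for a fixed pixel value `v` and fixed centers `c`. -/
noncomputable def pixelLaw {q k : ℕ} [NeZero k] (σ : ℝ≥0) (v : Pixel q) (c : Fin k → Pixel q) :
    Measure (Pixel q) :=
  (noise q σ).map fun w => nearest c (v + w)

/-- The distribution of the transformed image `x̃`, where `x̃_i` is the center nearest to
`x_i + w_i`, the noise vectors `w_1, …, w_n` are independent `N(0, σ² I)` vectors, independent of
the centers `c`, and the same centers are used for all pixels. -/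
noncomputable def imageLaw {n q s k : ℕ} [NeZero k] (σ τ : ℝ≥0)
    (sel : Kernel (Fin s → Pixel q) (Fin k → Pixel q)) (x : Image n q) :
    Measure (Image n q) :=
  ((centerLaw τ sel x).prod (Measure.pi fun _ : Fin n => noise q σ)).map
    fun p i => nearest p.1 (x i + p.2 i)

end RandDisc

namespace RandDisc

/-! ### Kullback-Leibler divergence: kernels, push-forwards, products -/

section KullbackLeibler

variable {α β γ : Type*} [MeasurableSpace α] [MeasurableSpace β]
  [MeasurableSpace γ]

section Kernel

variable [MeasurableSpace.CountableOrCountablyGenerated α β] {κ η : Kernel α β}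
  [IsFiniteKernel κ] [IsFiniteKernel η]

/-! Forgetting the centers can only decrease the divergence, so it suffices to bound that of the
joint laws of centers and image. By the chain rule this is the divergence of the two center laws
plus the mean, over the centers `u` of `x`, of the divergence of the images given `u`
(`klDiv_map_prod_le`).

Given `u` the pixels are independent, so the second term is at most a sum over pixels
(`klDiv_pi_le`), and `x' i - x i` is an admissible `Δ` that does not depend on `u`.

The centers are obtained by one kernel from the samples, so data processing reduces the first term
to the samples. Given the indices, whose law is the same for both images, these are two Gaussian
products that differ by a shift of at most `ε` in each of `s * q` coordinates, at a cost of at most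
`ε ^ 2 / (2 * τ ^ 2)` each. -/

theorem klDiv_kernel_eq_lintegral {a : α} (h : κ a ≪ η a) :
    klDiv (κ a) (η a) = ∫⁻ b, ENNReal.ofReal (klFun (κ.rnDeriv η a b).toReal) ∂η a := by
  rw [klDiv_eq_lintegral_klFun_of_ac h]
  refine lintegral_congr_ae ?_
  filter_upwards [Kernel.rnDeriv_eq_rnDeriv_measure (κ := κ) (η := η) (a := a)] with b hb
  rw [hb]

/-- The points where `κ a ≪ η a` form a measurable set, and on it the divergence is the integral of
a jointly measurable function; elsewhere it is `∞`. -/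
theorem measurable_klDiv_kernel (κ η : Kernel α β) [IsFiniteKernel κ] [IsFiniteKernel η] :
    Measurable fun a => klDiv (κ a) (η a) := by
  classical
  have h : (fun a => klDiv (κ a) (η a)) = fun a => if κ a ≪ η a then
      ∫⁻ b, ENNReal.ofReal (klFun (κ.rnDeriv η a b).toReal) ∂η a else ∞ := by
    ext a
    split_ifs with ha
    · exact klDiv_kernel_eq_lintegral ha
    · exact klDiv_of_not_ac ha
  rw [h]
  refine Measurable.ite (Kernel.measurableSet_absolutelyContinuous κ η) ?_ measurable_const
  refine Measurable.lintegral_kernel_prod_right (κ := η)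
    (f := fun a b => ENNReal.ofReal (klFun (κ.rnDeriv η a b).toReal)) ?_
  have := Kernel.measurable_rnDeriv κ η
  unfold Function.uncurry
  fun_prop

/-- Integral form of the conditional Kullback-Leibler divergence. -/
theorem klDiv_compProd_eq_lintegral (μ : Measure α) [IsFiniteMeasure μ] (κ η : Kernel α β)
    [IsFiniteKernel κ] [IsFiniteKernel η] :
    klDiv (μ ⊗ₘ κ) (μ ⊗ₘ η) = ∫⁻ a, klDiv (κ a) (η a) ∂μ := by
  by_cases hac : ∀ᵐ a ∂μ, κ a ≪ η a
  · have hm := Kernel.measurable_rnDeriv κ η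
    -- Fibrewise absolute continuity makes the kernel derivative a density of the joint measures.
    have heq : μ ⊗ₘ κ = (μ ⊗ₘ η).withDensity fun p => κ.rnDeriv η p.1 p.2 := by
      ext s hs
      rw [withDensity_apply _ hs, ← lintegral_indicator hs,
        Measure.lintegral_compProd (hm.indicator hs), Measure.compProd_apply hs]
      refine lintegral_congr_ae ?_
      filter_upwards [hac] with a ha
      rw [← Kernel.setLIntegral_rnDeriv ha (measurable_prodMk_left hs),
        ← lintegral_indicator (measurable_prodMk_left hs)]
      rfl
    have hrn : (μ ⊗ₘ κ).rnDeriv (μ ⊗ₘ η) =ᵐ[μ ⊗ₘ η] fun p => κ.rnDeriv η p.1 p.2 := by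
      conv_lhs => rw [heq]
      exact Measure.rnDeriv_withDensity _ hm
    rw [klDiv_eq_lintegral_klFun_of_ac (Measure.absolutelyContinuous_compProd_right_iff.2 hac)]
    have : ∫⁻ p, ENNReal.ofReal (klFun ((μ ⊗ₘ κ).rnDeriv (μ ⊗ₘ η) p).toReal) ∂(μ ⊗ₘ η) =
        ∫⁻ p, ENNReal.ofReal (klFun (κ.rnDeriv η p.1 p.2).toReal) ∂(μ ⊗ₘ η) := by
      refine lintegral_congr_ae ?_
      filter_upwards [hrn] with p hp
      rw [hp]
    rw [this, Measure.lintegral_compProd (by fun_prop)]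
    refine lintegral_congr_ae ?_
    filter_upwards [hac] with a ha
    exact (klDiv_kernel_eq_lintegral ha).symm
  · rw [klDiv_of_not_ac (by rwa [Measure.absolutelyContinuous_compProd_right_iff])]
    -- A finite integral would make the divergence finite, hence `κ a ≪ η a`, for almost every `a`.
    by_contra! h
    refine hac ?_
    filter_upwards [ae_lt_top (measurable_klDiv_kernel κ η) h.symm] with a ha
    exact (klDiv_ne_top_iff.1 ha.ne).1

end Kernel

/-- The kernel that sends `a` to the distribution of `f (a, b)`, where `b ∼ ν`. -/
noncomputable def pushKernel (ν : Measure β) (f : α × β → γ) : Kernel α γ :=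
  (Kernel.id ×ₖ Kernel.const α ν).map f

section PushKernel

variable {f g : α × β → γ}

theorem pushKernel_apply (ν : Measure β) [SFinite ν] (hf : Measurable f) (a : α) :
    pushKernel ν f a = ν.map fun b => f (a, b) := by
  rw [pushKernel, Kernel.map_apply _ hf, Kernel.prod_apply, Kernel.id_apply, Kernel.const_apply,
    Measure.dirac_prod, Measure.map_map hf measurable_prodMk_left]
  rfl

theorem isMarkovKernel_pushKernel (ν : Measure β) [IsProbabilityMeasure ν] (hf : Measurable f) :
    IsMarkovKernel (pushKernel ν f) :=
  Kernel.IsMarkovKernel.map _ hf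

theorem bind_pushKernel (μ : Measure α) [SFinite μ] (ν : Measure β) [SFinite ν]
    (hf : Measurable f) : μ.bind (pushKernel ν f) = (μ.prod ν).map f := by
  rw [pushKernel, ← Measure.map_comp _ _ hf, ← Measure.compProd_eq_comp_prod,
    Measure.compProd_const]

/-- Two random functions of a common independent noise: the divergence of their laws is at most
that of the laws of the inputs plus the mean divergence for a fixed input. -/
theorem klDiv_map_prod_le [MeasurableSpace.CountablyGenerated γ] (μ μ' : Measure α)
    [IsProbabilityMeasure μ] [IsProbabilityMeasure μ'] (ν : Measure β) [IsProbabilityMeasure ν]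
    (hf : Measurable f) (hg : Measurable g) :
    klDiv ((μ.prod ν).map f) ((μ'.prod ν).map g) ≤ klDiv μ μ' +
      ∫⁻ a, klDiv (ν.map fun b => f (a, b)) (ν.map fun b => g (a, b)) ∂μ := by
  have := isMarkovKernel_pushKernel ν hf
  have := isMarkovKernel_pushKernel ν hg
  simp_rw [← pushKernel_apply ν hf, ← pushKernel_apply ν hg]
  -- The chain rule, read backwards, turns the bound into the divergence of the joint laws of input
  -- and output; the left side concerns their second marginals.
  rw [← klDiv_compProd_eq_lintegral, ← klDiv_compProd_eq_add, ← bind_pushKernel μ ν hf,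
    ← bind_pushKernel μ' ν hg, ← Measure.snd_compProd, ← Measure.snd_compProd]
  exact klDiv_map_le _ _ measurable_snd

end PushKernel

theorem klDiv_prod_le (μ μ' : Measure α) (ν ν' : Measure β)
    [IsProbabilityMeasure μ] [IsProbabilityMeasure μ'] [IsProbabilityMeasure ν]
    [IsProbabilityMeasure ν'] :
    klDiv (μ.prod ν) (μ'.prod ν') ≤ klDiv μ μ' + klDiv ν ν' := by
  rw [← Measure.compProd_const, ← Measure.compProd_const, klDiv_compProd_eq_add,
    Measure.compProd_const, Measure.compProd_const]
  refine add_le_add le_rfl ?_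
  -- Adjoining the common factor `μ` to `ν` and `ν'` leaves their divergence unchanged; only the
  -- order of the factors remains to be swapped.
  rw [← klDiv_compProd_left ν ν' (Kernel.const β μ), Measure.compProd_const,
    Measure.compProd_const, ← Measure.prod_swap (μ := ν) (ν := μ),
    ← Measure.prod_swap (μ := ν') (ν := μ)]
  exact klDiv_map_le (ν.prod μ) (ν'.prod μ) measurable_swap

/-- Subadditivity of the Kullback-Leibler divergence for product measures. -/
theorem klDiv_pi_le {n : ℕ} (μ ν : Fin n → Measure α)
    [∀ i, IsProbabilityMeasure (μ i)] [∀ i, IsProbabilityMeasure (ν i)] :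
    klDiv (Measure.pi μ) (Measure.pi ν) ≤ ∑ i, klDiv (μ i) (ν i) := by
  induction n with
  | zero =>
    rw [Measure.pi_of_empty, Measure.pi_of_empty (μ := ν), klDiv_self]
    simp
  | succ n ih =>
    rw [← (measurePreserving_piFinSuccAbove μ 0).symm.map_eq,
      ← (measurePreserving_piFinSuccAbove ν 0).symm.map_eq, Fin.sum_univ_succ]
    refine (klDiv_map_le ((μ 0).prod (Measure.pi fun j => μ (Fin.succAbove 0 j)))
      ((ν 0).prod (Measure.pi fun j => ν (Fin.succAbove 0 j))) (MeasurableEquiv.measurable _)).trans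
      ((klDiv_prod_le _ _ _ _).trans ?_)
    exact add_le_add le_rfl (ih _ _)

end KullbackLeibler

/-! ### Gaussian noise and the law of the samples -/

theorem klDiv_gaussianReal (m m' : ℝ) {v : ℝ≥0} (hv : v ≠ 0) :
    klDiv (gaussianReal m v) (gaussianReal m' v) = ENNReal.ofReal ((m - m') ^ 2 / (2 * v)) := by
  have hv' : (v : ℝ) ≠ 0 := by exact_mod_cast hv
  have hac : gaussianReal m v ≪ gaussianReal m' v :=
    (gaussianReal_absolutelyContinuous m hv).trans (gaussianReal_absolutelyContinuous' m' hv)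
  -- With equal variances the quadratic terms cancel, so the log-likelihood ratio is affine and its
  -- integral needs only the mean `m`.
  have hllr : llr (gaussianReal m v) (gaussianReal m' v) =ᵐ[gaussianReal m v]
      fun x => (m - m') / v * x - (m ^ 2 - m' ^ 2) / (2 * v) := by
    have h1 := Measure.rnDeriv_withDensity_right (gaussianReal m v) volume
      (measurable_gaussianPDF m' v).aemeasurable
      (ae_of_all _ fun x => (gaussianPDF_pos m' hv x).ne') (ae_of_all _ fun x => gaussianPDF_ne_top)
    rw [← gaussianReal_of_var_ne_zero m' hv] at h1
    refine (gaussianReal_absolutelyContinuous m hv).ae_le ?_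
    filter_upwards [h1, rnDeriv_gaussianReal m v] with x hx hx'
    rw [llr, hx, hx', ENNReal.toReal_mul, ENNReal.toReal_inv, toReal_gaussianPDF,
      toReal_gaussianPDF, gaussianPDFReal, gaussianPDFReal]
    have hs : (√(2 * Real.pi * v))⁻¹ ≠ 0 := by positivity
    rw [Real.log_mul (inv_ne_zero (by positivity)) (by positivity), Real.log_inv,
      Real.log_mul hs (by positivity), Real.log_mul hs (by positivity), Real.log_exp, Real.log_exp]
    field_simp
    ring
  have hid : Integrable (fun x : ℝ => x) (gaussianReal m v) :=
    (memLp_id_gaussianReal (μ := m) (v := v) 1).integrable (by simp)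
  have hint : Integrable (llr (gaussianReal m v) (gaussianReal m' v)) (gaussianReal m v) :=
    (integrable_congr hllr).2 ((hid.const_mul _).sub (integrable_const _))
  rw [klDiv_of_ac_of_integrable hac hint, integral_congr_ae hllr,
    integral_sub (hid.const_mul _) (integrable_const _), integral_const_mul,
    integral_id_gaussianReal]
  congr 1
  simp
  field_simp
  ring

instance isProbabilityMeasure_noise (q : ℕ) (ρ : ℝ≥0) : IsProbabilityMeasure (noise q ρ) := by
  unfold noise
  infer_instance

theorem map_const_add_noise {q : ℕ} (ρ : ℝ≥0) (v : Pixel q) :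
    (noise q ρ).map (fun w => v + w) = Measure.pi fun a => gaussianReal (v a) (ρ ^ 2) := by
  have : ∀ a, SigmaFinite ((gaussianReal 0 (ρ ^ 2)).map fun w => v a + w) := fun a => by
    rw [gaussianReal_map_const_add]
    infer_instance
  have h := Measure.pi_map_pi (μ := fun _ : Fin q => gaussianReal 0 (ρ ^ 2))
    (f := fun a w => v a + w) fun a => (measurable_const_add _).aemeasurable
  simp_rw [gaussianReal_map_const_add, zero_add] at h
  exact h

theorem klDiv_map_const_add_noise_le {q : ℕ} {ρ : ℝ≥0} (hρ : 0 < ρ) {ε : ℝ} {v v' : Pixel q}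
    (h : ∀ a, |v a - v' a| ≤ ε) :
    klDiv ((noise q ρ).map fun w => v + w) ((noise q ρ).map fun w => v' + w) ≤
      ENNReal.ofReal (q * (ε ^ 2 / (2 * ρ ^ 2))) := by
  rw [map_const_add_noise, map_const_add_noise]
  refine (klDiv_pi_le _ _).trans ?_
  rw [ENNReal.ofReal_mul (by positivity), ENNReal.ofReal_natCast, ← nsmul_eq_mul]
  conv_rhs => rw [← Fintype.card_fin q, ← Finset.card_univ]
  refine Finset.sum_le_card_nsmul _ _ _ fun a _ => ?_
  rw [klDiv_gaussianReal _ _ (pow_pos hρ 2).ne']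
  refine ENNReal.ofReal_le_ofReal ?_
  push_cast
  refine div_le_div_of_nonneg_right ?_ (by positivity)
  exact sq_le_sq' (neg_le_of_abs_le (h a)) (le_of_abs_le (h a))

instance isProbabilityMeasure_sampleLaw {n q : ℕ} [NeZero n] (s : ℕ) (τ : ℝ≥0) (x : Image n q) :
    IsProbabilityMeasure (sampleLaw s τ x) := by
  have : IsProbabilityMeasure (uniformOn (Set.univ : Set (Fin n))) :=
    isProbabilityMeasure_uniformOn Set.finite_univ Set.univ_nonempty
  unfold sampleLaw
  exact Measure.isProbabilityMeasure_map (Measurable.aemeasurable (by fun_prop))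

instance isProbabilityMeasure_centerLaw {n q s k : ℕ} [NeZero n] (τ : ℝ≥0)
    (sel : Kernel (Fin s → Pixel q) (Fin k → Pixel q)) [IsMarkovKernel sel] (x : Image n q) :
    IsProbabilityMeasure (centerLaw τ sel x) := by
  unfold centerLaw
  infer_instance

/-- The sample laws are Gaussian mixtures. Conditioning on the indices leaves products of shifted
Gaussians, and the indices themselves contribute no divergence. -/
theorem klDiv_sampleLaw_le {n q : ℕ} [NeZero n] (s : ℕ) {τ : ℝ≥0} (hτ : 0 < τ) {ε : ℝ}
    {x x' : Image n q} (h : ∀ i a, |x i a - x' i a| ≤ ε) :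
    klDiv (sampleLaw s τ x) (sampleLaw s τ x') ≤
      ENNReal.ofReal (s * q * ε ^ 2 / (2 * τ ^ 2)) := by
  have : IsProbabilityMeasure (uniformOn (Set.univ : Set (Fin n))) :=
    isProbabilityMeasure_uniformOn Set.finite_univ Set.univ_nonempty
  have hm : ∀ y : Image n q, Measurable
      fun (p : (Fin s → Fin n) × (Fin s → Pixel q)) j => y (p.1 j) + p.2 j := fun y => by fun_prop
  refine (klDiv_map_prod_le _ _ _ (hm x) (hm x')).trans ?_
  rw [klDiv_self, zero_add]
  refine (lintegral_mono (g := fun _ => ENNReal.ofReal (s * q * ε ^ 2 / (2 * τ ^ 2)))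
    fun idx => ?_).trans (by simp)
  have hprob : ∀ (y : Image n q) j,
      IsProbabilityMeasure ((noise q τ).map fun w => y (idx j) + w) := fun y j =>
    Measure.isProbabilityMeasure_map (measurable_const_add _).aemeasurable
  have hpi : ∀ y : Image n q,
      (Measure.pi fun _ : Fin s => noise q τ).map (fun b j => y (idx j) + b j) =
        Measure.pi fun j => (noise q τ).map fun w => y (idx j) + w := fun y =>
    have := hprob y
    Measure.pi_map_pi fun j => (measurable_const_add _).aemeasurable
  have := hprob x
  have := hprob x'
  rw [hpi, hpi]
  refine (klDiv_pi_le _ _).trans ?_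
  have hs : (s : ℝ) * q * ε ^ 2 / (2 * τ ^ 2) = s * (q * (ε ^ 2 / (2 * τ ^ 2))) := by ring
  rw [hs, ENNReal.ofReal_mul (by positivity), ENNReal.ofReal_natCast, ← nsmul_eq_mul]
  refine (Finset.sum_le_card_nsmul _ _ _ fun j _ =>
    klDiv_map_const_add_noise_le hτ fun a => h (idx j) a).trans_eq ?_
  rw [Finset.card_univ, Fintype.card_fin]

/-! ### Pixels for fixed centers -/

section PixelLaw

variable {q k : ℕ} [NeZero k]

theorem measurable_nearest_add (v : Pixel q) :
    Measurable fun p : (Fin k → Pixel q) × Pixel q => nearest p.1 (v + p.2) :=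
  measurable_nearest.comp (measurable_fst.prodMk (measurable_snd.const_add v))

theorem measurable_nearest_const_add (v : Pixel q) (c : Fin k → Pixel q) :
    Measurable fun w => nearest c (v + w) :=
  (measurable_nearest_add v).comp measurable_prodMk_left

instance isProbabilityMeasure_pixelLaw (σ : ℝ≥0) (v : Pixel q) (c : Fin k → Pixel q) :
    IsProbabilityMeasure (pixelLaw σ v c) :=
  Measure.isProbabilityMeasure_map (measurable_nearest_const_add v c).aemeasurable

/-- Needed to exchange the sum over pixels with the integral over the centers. -/
theorem measurable_klDiv_pixelLaw (σ : ℝ≥0) (v v' : Pixel q) :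
    Measurable fun u : Fin k → Pixel q => klDiv (pixelLaw σ v u) (pixelLaw σ v' u) := by
  have := isMarkovKernel_pushKernel (noise q σ) (measurable_nearest_add (k := k) v)
  have := isMarkovKernel_pushKernel (noise q σ) (measurable_nearest_add (k := k) v')
  have h := measurable_klDiv_kernel
    (pushKernel (noise q σ) fun p : (Fin k → Pixel q) × Pixel q => nearest p.1 (v + p.2))
    (pushKernel (noise q σ) fun p : (Fin k → Pixel q) × Pixel q => nearest p.1 (v' + p.2))
  simp_rw [pushKernel_apply _ (measurable_nearest_add _)] at h
  exact h

theorem map_nearest_pi_noise {n : ℕ} (σ : ℝ≥0) (x : Image n q) (c : Fin k → Pixel q) :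
    (Measure.pi fun _ : Fin n => noise q σ).map (fun w i => nearest c (x i + w i)) =
      Measure.pi fun i => pixelLaw σ (x i) c :=
  have (i : Fin n) : SigmaFinite ((noise q σ).map fun w => nearest c (x i + w)) :=
    inferInstanceAs (SigmaFinite (pixelLaw σ (x i) c))
  Measure.pi_map_pi fun i => (measurable_nearest_const_add (x i) c).aemeasurable

end PixelLaw

end RandDisc

theorem proposition1 {n q s k : ℕ} [NeZero n] [NeZero k] (σ τ : ℝ≥0) (hτ : 0 < τ)
    (sel : Kernel (Fin s → RandDisc.Pixel q) (Fin k → RandDisc.Pixel q)) [IsMarkovKernel sel]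
    (ε : ℝ) (x x' : RandDisc.Image n q) (hx : ‖x - x'‖ ≤ ε) :
    klDiv (RandDisc.imageLaw σ τ sel x) (RandDisc.imageLaw σ τ sel x') ≤
      ENNReal.ofReal ((s : ℝ) * (q : ℝ) * ε ^ 2 / (2 * (τ : ℝ) ^ 2)) +
        ∑ i : Fin n, ⨆ Δ ∈ Set.Icc (fun _ : Fin q => -ε) (fun _ : Fin q => ε),
          ∫⁻ u, klDiv (RandDisc.pixelLaw σ (x i) u) (RandDisc.pixelLaw σ (x i + Δ) u)
            ∂(RandDisc.centerLaw τ sel x) := by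
  have h : ∀ i a, |x i a - x' i a| ≤ ε := fun i a =>
    ((norm_le_pi_norm ((x - x') i) a).trans (norm_le_pi_norm (x - x') i)).trans hx
  have hm : ∀ y : RandDisc.Image n q, Measurable
      fun (p : (Fin k → RandDisc.Pixel q) × (Fin n → RandDisc.Pixel q)) i =>
        RandDisc.nearest p.1 (y i + p.2 i) := fun y => measurable_pi_lambda _ fun i =>
    (RandDisc.measurable_nearest_add (y i)).comp
      (measurable_fst.prodMk ((measurable_pi_apply i).comp measurable_snd))
  refine (RandDisc.klDiv_map_prod_le _ _ _ (hm x) (hm x')).trans (add_le_add ?_ ?_)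
  -- Data processing through the common selection kernel.
  · exact (klDiv_comp_right_le _ _ sel).trans (RandDisc.klDiv_sampleLaw_le s hτ h)
  · simp_rw [RandDisc.map_nearest_pi_noise]
    refine (lintegral_mono fun u => RandDisc.klDiv_pi_le _ _).trans ?_
    rw [lintegral_finsetSum _ fun i _ => RandDisc.measurable_klDiv_pixelLaw σ (x i) (x' i)]
    refine Finset.sum_le_sum fun i _ => ?_
    -- This `Δ` is the same for all centers, so the supremum may stand outside the expectation.
    refine le_iSup₂_of_le (x' i - x i) ⟨fun a => ?_, fun a => ?_⟩ (by simp)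
    · exact (neg_le_sub_iff_le_add.2 (by linarith [le_of_abs_le (h i a)]))
    · exact sub_le_iff_le_add.2 (by linarith [neg_le_of_abs_le (h i a)])
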